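/- All graphs are finite multigraphs without loops. For a graph $X$ let $\mathrm{Div}(X)$ be the free abelian group on $V(X)$, and let $\mathrm{Pic}(X)$ be its quotient by the subgroup generated by the divisors $\sum_{vw\in E(X)}(v-w)$, $v\in V(X)$ (edges counted with multiplicity). The Jacobian $\mathrm{Jac}(X)$ is the kernel of the degree homomorphism $\mathrm{Pic}(X)\to\mathbb Z$. Let $R$ be Tutte's rotor of order $3$, that is, the graph with the $10$ vertices $t_i,m_i,u_i$ ($i\in\mathbb Z/3$) and $o$, and the $15$ edges $t_im_i$, $m_it_{i+1}$, $u_it_i$, $u_im_i$, $u_io$ ($i\in\mathbb Z/3$). Write $a=t_0$, $b=t_1$, $c=t_2$, and let $f$ be the automorphism of $R$ of order $3$ that fixes $o$ and sends $t_i,m_i,u_i$ to $t_{i+1},m_{i+1},u_{i+1}$; thus $f(a)=b$, $f(b)=c$, $f(c)=a$. Let $n\ge 2$, let $S=C_n$ be the cycle graph on $n$ vertices (two parallel edges if $n=2$), let $g:\{a,b,c\}\to V(S)$ be any map, not necessarily injective, and let $\sigma$ be any permutation of $\{a,b,c\}$. Let $G$ be the graph obtained from the disjoint union of $R$ and $S$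 by adding, for each $x\in\{a,b,c\}$, a new edge joining $x$ to $g(x)$, and let $H$ be the graph obtained from the same disjoint union by adding, for each $x\in\{a,b,c\}$, a new edge joining $x$ to $g(\sigma(x))$. (If $\sigma$ is a transposition, then $H$ is $G$ with the rotor reflected before it is attached; if $\sigma=f|_{\{a,b,c\}}$, then $H$ joins $f^i(a)$ to $g(f^{i+1}(a))$.) Then $$\mathrm{Jac}(G)\cong\mathrm{Jac}(H).$$ -/

import Mathlib

open scoped Graph

/-! ### Divisors, Picard group and Jacobian of a multigraph -/

namespace Graph

variable {α β : Type*}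

/-- The number of edges of `G` joining `x` and `y`. -/
noncomputable def edgeMult (G : Graph α β) (x y : α) : ℕ :=
  {e | G.IsLink e x y}.ncard

/-- The group of divisors: the free abelian group on the vertices of `G`. -/
abbrev Divisor (G : Graph α β) : Type _ := V(G) →₀ ℤ

/-- The degree `∑ D(v)` of a divisor. -/
noncomputable def divisorDegree (G : Graph α β) : G.Divisor →+ ℤ :=
  Finsupp.liftAddHom fun _ => AddMonoidHom.id ℤ

/-- The divisor `∑_{vw ∈ E(G)} (v - w)`, the sum being over all edges at `v` counted with
multiplicity. A borrowing move at `v` adds it, a lending move at `v` subtracts it. -/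
noncomputable def borrowing (G : Graph α β) (v : V(G)) : G.Divisor :=
  ∑ᶠ w : V(G), G.edgeMult v w • (Finsupp.single v (1 : ℤ) - Finsupp.single w 1)

/-- The divisors that arise from `0` by finitely many lending and borrowing moves. -/
noncomputable def principalDivisors (G : Graph α β) : AddSubgroup G.Divisor :=
  AddSubgroup.closure (Set.range G.borrowing)

/-- The Picard group: divisors modulo lending and borrowing moves. -/
abbrev Pic (G : Graph α β) : Type _ := G.Divisor ⧸ G.principalDivisors

theorem divisorDegree_borrowing (G : Graph α β) (v : V(G)) :
    G.divisorDegree (G.borrowing v) = 0 := by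
  unfold borrowing
  by_cases h : (Function.support fun w : V(G) =>
      G.edgeMult v w • (Finsupp.single v (1 : ℤ) - Finsupp.single w 1)).Finite
  · rw [AddMonoidHom.map_finsum _ h]
    refine (finsum_congr fun w => ?_).trans finsum_zero
    rw [map_nsmul, map_sub]
    simp [divisorDegree]
  · rw [finsum_of_infinite_support h, map_zero]

theorem principalDivisors_le_ker (G : Graph α β) :
    G.principalDivisors ≤ G.divisorDegree.ker := by
  rw [principalDivisors, AddSubgroup.closure_le]
  rintro _ ⟨v, rfl⟩
  exact G.divisorDegree_borrowing v

/-- The degree homomorphism `Pic(G) → ℤ`. -/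
noncomputable def picDegree (G : Graph α β) : G.Pic →+ ℤ :=
  QuotientAddGroup.lift G.principalDivisors G.divisorDegree G.principalDivisors_le_ker

/-- The Jacobian of `G`: the kernel of the degree homomorphism on the Picard group. -/
noncomputable def jacobian (G : Graph α β) : AddSubgroup G.Pic := G.picDegree.ker

/-! ### Cycle graphs, and joining two graphs by new edges -/

/-- The cycle graph `C_n` with vertices and edges indexed by `ℤ/n`: the edge `i` joins `i` and
`i + 1`. (For `n = 2` it consists of two parallel edges.) -/
def cycleMultigraph (n : ℕ) : Graph (ZMod n) (ZMod n) where
  vertexSet := Set.univ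
  edgeSet := Set.univ
  IsLink e x y := s(x, y) = s(e, e + 1)
  isLink_symm _ _ := ⟨fun x y h => (Sym2.eq_swap (a := y) (b := x)).trans h⟩
  eq_or_eq_of_isLink_of_isLink e x y v w h h' := by
    have := h.trans h'.symm
    rw [Sym2.eq_iff] at this
    tauto
  edge_mem_iff_exists_isLink e := ⟨fun _ => ⟨e, e + 1, rfl⟩, fun _ => Set.mem_univ _⟩
  left_mem_of_isLink _ _ _ _ := Set.mem_univ _

/-- The disjoint union of `G` and `H` together with one new edge for each `i : ι`, which joins the
vertex `s i` of `G` to the vertex `t i` of `H`. -/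
def joinByEdges {γ δ ι : Type*} (G : Graph α β) (H : Graph γ δ) (s : ι → V(G)) (t : ι → V(H)) :
    Graph (α ⊕ γ) (β ⊕ δ ⊕ ι) where
  vertexSet := Sum.inl '' V(G) ∪ Sum.inr '' V(H)
  IsLink e x y := match e with
    | .inl e => ∃ u v, G.IsLink e u v ∧ x = .inl u ∧ y = .inl v
    | .inr (.inl e) => ∃ u v, H.IsLink e u v ∧ x = .inr u ∧ y = .inr v
    | .inr (.inr i) => s(x, y) = s(.inl (s i : α), .inr (t i : γ))
  isLink_symm e _ := by
    refine ⟨fun x y h => ?_⟩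
    rcases e with e | e | i
    · obtain ⟨u, v, h, hx, hy⟩ := h
      exact ⟨v, u, h.symm, hy, hx⟩
    · obtain ⟨u, v, h, hx, hy⟩ := h
      exact ⟨v, u, h.symm, hy, hx⟩
    · exact (Sym2.eq_swap (a := y) (b := x)).trans h
  eq_or_eq_of_isLink_of_isLink e x y v w h h' := by
    rcases e with e | e | i
    · obtain ⟨a, b, h, rfl, rfl⟩ := h
      obtain ⟨c, d, h', rfl, rfl⟩ := h'
      rcases h.left_eq_or_eq h' with rfl | rfl <;> simp
    · obtain ⟨a, b, h, rfl, rfl⟩ := h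
      obtain ⟨c, d, h', rfl, rfl⟩ := h'
      rcases h.left_eq_or_eq h' with rfl | rfl <;> simp
    · have := h.trans h'.symm
      rw [Sym2.eq_iff] at this
      tauto
  left_mem_of_isLink e x y h := by
    rcases e with e | e | i
    · obtain ⟨u, v, h, rfl, rfl⟩ := h
      exact .inl ⟨u, h.left_mem, rfl⟩
    · obtain ⟨u, v, h, rfl, rfl⟩ := h
      exact .inr ⟨u, h.left_mem, rfl⟩
    · rcases Sym2.eq_iff.1 h with ⟨rfl, -⟩ | ⟨rfl, -⟩
      · exact .inl ⟨_, (s i).2, rfl⟩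
      · exact .inr ⟨_, (t i).2, rfl⟩

end Graph

/-! ### Tutte's rotor of order 3 -/

/-- The ten vertices of Tutte's rotor of order 3. The outer cycle is the hexagon
`terminal 0, mid 0, terminal 1, mid 1, terminal 2, mid 2`, and the terminals are the vertices
usually called `a, b, c`. -/
inductive TutteRotorVertex
  | terminal (i : ZMod 3)
  | mid (i : ZMod 3)
  | inner (i : ZMod 3)
  | center
  deriving DecidableEq

namespace TutteRotorVertex

/-- The fifteen edges of Tutte's rotor, each listed in one direction. -/
def Link : TutteRotorVertex → TutteRotorVertex → Prop
  | terminal i, mid j => j = i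
  | mid i, terminal j => j = i + 1
  | inner i, terminal j => j = i
  | inner i, mid j => j = i
  | center, inner _ => True
  | _, _ => False

/-- The rotation `terminal i ↦ terminal (i + 1)` of the vertices; so `a ↦ b ↦ c ↦ a`. -/
def rotate : Equiv.Perm TutteRotorVertex where
  toFun
    | terminal i => terminal (i + 1)
    | mid i => mid (i + 1)
    | inner i => inner (i + 1)
    | center => center
  invFun
    | terminal i => terminal (i - 1)
    | mid i => mid (i - 1)
    | inner i => inner (i - 1)
    | center => center
  left_inv x := by cases x <;> simp
  right_inv x := by cases x <;> simp

end TutteRotorVertex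

/-- Tutte's rotor of order 3, as a graph. -/
def tutteRotor : SimpleGraph TutteRotorVertex := SimpleGraph.fromRel TutteRotorVertex.Link

/-- The automorphism `f` of order 3 of Tutte's rotor. -/
def tutteRotation : tutteRotor ≃g tutteRotor where
  toEquiv := TutteRotorVertex.rotate
  map_rel_iff' {x y} := by
    cases x <;> cases y <;>
      simp [tutteRotor, TutteRotorVertex.rotate, TutteRotorVertex.Link]

theorem orderOf_tutteRotation : orderOf tutteRotation = 3 := by
  apply orderOf_eq_prime
  · ext x
    have h3 : ∀ i : ZMod 3, i + 1 + 1 + 1 = i := by decide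
    change TutteRotorVertex.rotate (TutteRotorVertex.rotate (TutteRotorVertex.rotate x)) = x
    cases x <;> simp [TutteRotorVertex.rotate, h3]
  · intro h
    have := DFunLike.congr_fun h (TutteRotorVertex.terminal 0)
    have h2 : TutteRotorVertex.terminal (0 + 1) = TutteRotorVertex.terminal 0 := this
    simp at h2

/-- The terminals are the vertices `f^i(v)`, where `v = terminal 0`. -/
theorem tutteRotation_pow_terminal (i : ℕ) :
    (tutteRotation ^ i) (TutteRotorVertex.terminal 0) = TutteRotorVertex.terminal i := by
  induction i with
  | zero => simp
  | succ k ih =>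
    rw [pow_succ', RelIso.mul_apply, ih, Nat.cast_succ]
    rfl

/-- The supergraph of the variation of Tutte's construction with back-graph `S`: the disjoint union
of Tutte's rotor and `S`, with a new edge between `f^i(v)` and the vertex `h i` of `S` for each of
the three terminals `f^i(v)`, `i ∈ ℤ/3`. -/
def tutteVariation {γ δ : Type*} (S : Graph γ δ) (h : ZMod 3 → V(S)) :
    Graph (TutteRotorVertex ⊕ γ) (Sym2 TutteRotorVertex ⊕ δ ⊕ ZMod 3) :=
  (Graph.ofSimpleGraph tutteRotor).joinByEdges S
    (fun i => ⟨TutteRotorVertex.terminal i, Set.mem_univ _⟩) h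

/-! Homomorphisms from `Pic` of a finite graph to an abelian group `A` are the `A`-valued harmonic
functions on its vertices, the universal one being `vertexClass`. So it suffices to match the
harmonic functions of the two graphs naturally in `A`; taking `A` to be the Picard groups themselves
gives mutually inverse maps.

Over a field of characteristic zero this is Tutte's argument: the response matrix of the rotor at
its three terminals is a symmetric circulant, hence invariant under reflections of the terminals.
That alone says nothing about torsion. `reflectRotor` is an integral version: it rewrites the rotor
values with integer coefficients, leaves `S` alone, preserves harmonicity (`laplacian_reflectRotor`)
and is an involution on harmonic functions (`reflectRotor_reflectRotor`). This settles
transpositions for every finite `S`; the other permutations are products of two. -/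

namespace Graph

/-! ### Harmonic functions and the Picard group -/

variable {α β γ δ ι A : Type*} [AddCommGroup A]

/-- The Laplacian `∑_{vw ∈ E(G)} (f v - f w)` of a function on the vertices, with values in an
abelian group. -/
noncomputable def laplacian (G : Graph α β) (f : α → A) (v : α) : A :=
  ∑ᶠ w, G.edgeMult v w • (f v - f w)

theorem edgeMult_eq_zero_of_right_notMem (G : Graph α β) {x y : α} (h : y ∉ V(G)) :
    G.edgeMult x y = 0 := by
  have : {e | G.IsLink e x y} = ∅ :=
    Set.eq_empty_of_forall_notMem fun e he => h (Graph.IsLink.right_mem he)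
  rw [edgeMult, this, Set.ncard_empty]

theorem laplacian_eq_finsum_vertexSet (G : Graph α β) (f : α → A) (v : α) :
    G.laplacian f v = ∑ᶠ w : V(G), G.edgeMult v w • (f v - f w) := by
  rw [finsum_set_coe_eq_finsum_mem (f := fun w => G.edgeMult v w • (f v - f w)) V(G)]
  refine finsum_congr fun w => ?_
  by_cases hw : w ∈ V(G)
  · simp [hw]
  · simp [hw, G.edgeMult_eq_zero_of_right_notMem hw]

open Classical in
/-- The class in the Picard group of a vertex, and `0` outside the vertex set. -/
noncomputable def vertexClass (G : Graph α β) (v : α) : G.Pic :=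
  if h : v ∈ V(G) then QuotientAddGroup.mk (Finsupp.single ⟨v, h⟩ 1) else 0

theorem vertexClass_coe (G : Graph α β) (v : V(G)) :
    G.vertexClass v = QuotientAddGroup.mk (Finsupp.single v 1) := by
  simp [vertexClass]

theorem vertexClass_of_notMem (G : Graph α β) {v : α} (hv : v ∉ V(G)) : G.vertexClass v = 0 :=
  dif_neg hv

theorem picDegree_vertexClass (G : Graph α β) {v : α} (hv : v ∈ V(G)) :
    G.picDegree (G.vertexClass v) = 1 := by
  rw [G.vertexClass_coe ⟨v, hv⟩]
  simp [picDegree, divisorDegree]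

theorem pic_hom_ext (G : Graph α β) {φ ψ : G.Pic →+ A}
    (h : ∀ v ∈ V(G), φ (G.vertexClass v) = ψ (G.vertexClass v)) : φ = ψ := by
  refine QuotientAddGroup.addMonoidHom_ext _ (Finsupp.addHom_ext' fun v => ?_)
  ext
  simpa [vertexClass_coe] using h v v.2

/-- At a vertex this is the defining relation of `Pic`; elsewhere there are no edges. With `picLift`
it makes `vertexClass` the universal harmonic function. -/
theorem laplacian_vertexClass [Finite α] (G : Graph α β) (v : α) :
    G.laplacian G.vertexClass v = 0 := by
  by_cases hv : v ∈ V(G)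
  · have h : (QuotientAddGroup.mk' G.principalDivisors) (G.borrowing ⟨v, hv⟩) = 0 :=
      (QuotientAddGroup.eq_zero_iff _).2 (AddSubgroup.subset_closure ⟨_, rfl⟩)
    rw [borrowing, AddMonoidHom.map_finsum _ (Set.toFinite _)] at h
    rw [laplacian_eq_finsum_vertexSet, ← h]
    refine finsum_congr fun w => ?_
    rw [map_nsmul, map_sub, G.vertexClass_coe w, G.vertexClass_coe ⟨v, hv⟩]
    rfl
  · refine (finsum_congr fun w => ?_).trans finsum_zero
    have : {e | G.IsLink e v w} = ∅ :=
      Set.eq_empty_of_forall_notMem fun e he => hv (Graph.IsLink.left_mem he)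
    rw [edgeMult, this, Set.ncard_empty]
    exact zero_nsmul _

/-- The homomorphism from the Picard group determined by a harmonic function. -/
noncomputable def picLift [Finite α] (G : Graph α β) (f : α → A)
    (hf : ∀ v ∈ V(G), G.laplacian f v = 0) : G.Pic →+ A :=
  QuotientAddGroup.lift G.principalDivisors
    (Finsupp.liftAddHom fun v : V(G) => (zmultiplesHom A) (f v)) <| by
      rw [principalDivisors, AddSubgroup.closure_le]
      rintro _ ⟨v, rfl⟩
      rw [SetLike.mem_coe, AddMonoidHom.mem_ker, ← hf v v.2, borrowing,
        AddMonoidHom.map_finsum _ (Set.toFinite _), laplacian_eq_finsum_vertexSet]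
      refine finsum_congr fun w => ?_
      rw [map_nsmul, map_sub]
      simp

theorem picLift_vertexClass [Finite α] (G : Graph α β) (f : α → A)
    (hf : ∀ v ∈ V(G), G.laplacian f v = 0) {v : α} (hv : v ∈ V(G)) :
    G.picLift f hf (G.vertexClass v) = f v := by
  rw [G.vertexClass_coe ⟨v, hv⟩]
  simp [picLift]

/-- Isomorphic Picard groups with compatible degrees have isomorphic Jacobians. -/
theorem nonempty_jacobian_addEquiv {G : Graph α β} {H : Graph γ δ} (e : G.Pic ≃+ H.Pic)
    (he : ∀ x, H.picDegree (e x) = G.picDegree x) : Nonempty (G.jacobian ≃+ H.jacobian) := by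
  have : G.jacobian.map (e : G.Pic →+ H.Pic) = H.jacobian := by
    ext y
    constructor
    · rintro ⟨x, hx, rfl⟩
      exact (he x).trans hx
    · intro hy
      refine ⟨e.symm y, ?_, e.apply_symm_apply y⟩
      change G.picDegree (e.symm y) = 0
      rw [← he, e.apply_symm_apply]
      exact hy
  exact ⟨(e.addSubgroupMap G.jacobian).trans (AddEquiv.addSubgroupCongr this)⟩

/-- Two harmonic functions with values in the Picard groups of each other's graphs induce an
isomorphism of Jacobians if the homomorphisms they define are mutually inverse on vertices. -/
theorem nonempty_jacobian_addEquiv_of_harmonic [Finite α] [Finite γ] {G : Graph α β}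
    {H : Graph γ δ} (f : α → H.Pic) (g : γ → G.Pic)
    (hf : ∀ v, G.laplacian f v = 0) (hg : ∀ w, H.laplacian g w = 0)
    (hdeg : ∀ v ∈ V(G), H.picDegree (f v) = 1)
    (hgf : ∀ φ : H.Pic →+ G.Pic, (∀ w ∈ V(H), φ (H.vertexClass w) = g w) →
      ∀ v ∈ V(G), φ (f v) = G.vertexClass v)
    (hfg : ∀ φ : G.Pic →+ H.Pic, (∀ v ∈ V(G), φ (G.vertexClass v) = f v) →
      ∀ w ∈ V(H), φ (g w) = H.vertexClass w) :
    Nonempty (G.jacobian ≃+ H.jacobian) := by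
  let φ := G.picLift f fun v _ => hf v
  let ψ := H.picLift g fun w _ => hg w
  have hφ : ∀ v ∈ V(G), φ (G.vertexClass v) = f v := fun v hv => G.picLift_vertexClass f _ hv
  have hψ : ∀ w ∈ V(H), ψ (H.vertexClass w) = g w := fun w hw => H.picLift_vertexClass g _ hw
  have h₁ : ψ.comp φ = AddMonoidHom.id _ := G.pic_hom_ext fun v hv => by
    rw [AddMonoidHom.comp_apply, hφ v hv, hgf ψ hψ v hv, AddMonoidHom.id_apply]
  have h₂ : φ.comp ψ = AddMonoidHom.id _ := H.pic_hom_ext fun w hw => by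
    rw [AddMonoidHom.comp_apply, hψ w hw, hfg φ hφ w hw, AddMonoidHom.id_apply]
  refine nonempty_jacobian_addEquiv (φ.toAddEquiv ψ h₁ h₂) fun x => ?_
  have : H.picDegree.comp φ = G.picDegree := G.pic_hom_ext fun v hv => by
    rw [AddMonoidHom.comp_apply, hφ v hv, hdeg v hv, G.picDegree_vertexClass hv]
  exact DFunLike.congr_fun this x

/-! ### Laplacians of joined graphs and of simple graphs -/

section JoinByEdges

variable (G : Graph α β) (H : Graph γ δ) (s : ι → V(G)) (t : ι → V(H))

theorem edgeMult_joinByEdges_inl_inl (x y : α) :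
    (G.joinByEdges H s t).edgeMult (.inl x) (.inl y) = G.edgeMult x y := by
  have : {e | (G.joinByEdges H s t).IsLink e (.inl x) (.inl y)} =
      Sum.inl '' {e | G.IsLink e x y} := by
    ext (e | e | e) <;> simp [joinByEdges]
  rw [edgeMult, this, Set.ncard_image_of_injective _ Sum.inl_injective, edgeMult]

theorem edgeMult_joinByEdges_inr_inr (x y : γ) :
    (G.joinByEdges H s t).edgeMult (.inr x) (.inr y) = H.edgeMult x y := by
  have : {e | (G.joinByEdges H s t).IsLink e (.inr x) (.inr y)} =
      (Sum.inr ∘ Sum.inl) '' {e | H.IsLink e x y} := by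
    ext (e | e | e) <;> simp [joinByEdges]
  rw [edgeMult, this, Set.ncard_image_of_injective _ (Sum.inr_injective.comp Sum.inl_injective),
    edgeMult]

theorem edgeMult_joinByEdges_inl_inr (x : α) (y : γ) :
    (G.joinByEdges H s t).edgeMult (.inl x) (.inr y) = {i | (s i : α) = x ∧ (t i : γ) = y}.ncard := by
  have : {e | (G.joinByEdges H s t).IsLink e (.inl x) (.inr y)} =
      (Sum.inr ∘ Sum.inr) '' {i | (s i : α) = x ∧ (t i : γ) = y} := by
    ext (e | e | e) <;> simp [joinByEdges, eq_comm]
  rw [edgeMult, this, Set.ncard_image_of_injective _ (Sum.inr_injective.comp Sum.inr_injective)]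

theorem edgeMult_comm (x y : α) : G.edgeMult x y = G.edgeMult y x := by
  simp only [edgeMult, Graph.isLink_comm]

/-- Double counting: trades multiplicities of connecting edges for a sum over those edges. -/
theorem sum_ncard_smul [Fintype ι] [Fintype γ] [DecidableEq α] (a : ι → α) (b : ι → γ) (x : α)
    (f : γ → A) :
    ∑ y, {i | a i = x ∧ b i = y}.ncard • f y = ∑ i, if a i = x then f (b i) else 0 := by
  classical
  have h (y : γ) : {i | a i = x ∧ b i = y}.ncard • f y =
      ∑ i, if a i = x ∧ b i = y then f y else 0 := by
    rw [← Finset.sum_filter, Finset.sum_const, Set.ncard_eq_toFinset_card']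
    simp
  simp_rw [h]
  rw [Finset.sum_comm]
  refine Finset.sum_congr rfl fun i _ => ?_
  simp [ite_and]

variable [Fintype ι] [Finite α] [Finite γ]

theorem laplacian_joinByEdges_inl [DecidableEq α] (f : α ⊕ γ → A) (x : α) :
    (G.joinByEdges H s t).laplacian f (.inl x) = G.laplacian (f ∘ .inl) x +
      ∑ i, if (s i : α) = x then f (.inl x) - f (.inr (t i)) else 0 := by
  have := Fintype.ofFinite α
  have := Fintype.ofFinite γ
  rw [laplacian, laplacian, finsum_eq_sum_of_fintype, finsum_eq_sum_of_fintype,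
    Fintype.sum_sum_type]
  simp only [edgeMult_joinByEdges_inl_inl, edgeMult_joinByEdges_inl_inr]
  rw [sum_ncard_smul (fun i => (s i : α)) (fun i => (t i : γ)) x fun y => f (.inl x) - f (.inr y)]
  rfl

theorem laplacian_joinByEdges_inr [DecidableEq γ] (f : α ⊕ γ → A) (y : γ) :
    (G.joinByEdges H s t).laplacian f (.inr y) = H.laplacian (f ∘ .inr) y +
      ∑ i, if (t i : γ) = y then f (.inr y) - f (.inl (s i)) else 0 := by
  have := Fintype.ofFinite α
  have := Fintype.ofFinite γ
  rw [laplacian, laplacian, finsum_eq_sum_of_fintype, finsum_eq_sum_of_fintype,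
    Fintype.sum_sum_type, add_comm]
  have h (x : α) : (G.joinByEdges H s t).edgeMult (.inr y) (.inl x) =
      {i | (t i : γ) = y ∧ (s i : α) = x}.ncard := by
    rw [edgeMult_comm, edgeMult_joinByEdges_inl_inr]
    simp only [and_comm]
  simp only [edgeMult_joinByEdges_inr_inr, h]
  rw [sum_ncard_smul (fun i => (t i : γ)) (fun i => (s i : α)) y fun x => f (.inr y) - f (.inl x)]
  rfl

end JoinByEdges

open Classical in
theorem laplacian_ofSimpleGraph [Fintype α] (G : SimpleGraph α) (f : α → A) (v : α) :
    (ofSimpleGraph G).laplacian f v = ∑ w, if G.Adj v w then f v - f w else 0 := by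
  rw [laplacian, finsum_eq_sum_of_fintype]
  refine Finset.sum_congr rfl fun w _ => ?_
  split_ifs with h
  · have : {e | (ofSimpleGraph G).IsLink e v w} = {s(v, w)} := by
      ext e
      simp only [ofSimpleGraph, Set.mem_ofPred_eq, Set.mem_singleton_iff]
      exact ⟨fun h => h.1, fun he => ⟨he, he ▸ h⟩⟩
    rw [edgeMult, this, Set.ncard_singleton, one_smul]
  · have : {e | (ofSimpleGraph G).IsLink e v w} = ∅ :=
      Set.eq_empty_of_forall_notMem fun e he => h (by
        obtain ⟨rfl, he⟩ := he
        exact he)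
    rw [edgeMult, this, Set.ncard_empty, zero_smul]

end Graph

/-! ### Harmonicity equations of the supergraph -/

namespace TutteRotorVertex

/-- The vertices of the rotor, sorted by kind. -/
def equivSum : (ZMod 3 ⊕ ZMod 3) ⊕ (ZMod 3 ⊕ Unit) ≃ TutteRotorVertex where
  toFun := Sum.elim (Sum.elim terminal mid) (Sum.elim inner fun _ => center)
  invFun
    | terminal i => .inl (.inl i)
    | mid i => .inl (.inr i)
    | inner i => .inr (.inl i)
    | center => .inr (.inr ())
  left_inv x := by rcases x with (x | x) | (x | x) <;> rfl
  right_inv x := by cases x <;> rfl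

instance : Fintype TutteRotorVertex := Fintype.ofEquiv _ equivSum

theorem sum_eq {A : Type*} [AddCommMonoid A] (f : TutteRotorVertex → A) :
    ∑ x, f x = (∑ i, f (terminal i) + ∑ i, f (mid i)) + (∑ i, f (.inner i) + f center) := by
  rw [← equivSum.sum_comp, Fintype.sum_sum_type, Fintype.sum_sum_type, Fintype.sum_sum_type]
  simp [equivSum]

end TutteRotorVertex

open TutteRotorVertex

section RotorLaplacian

variable {γ δ A : Type*} [AddCommGroup A] [Finite γ] (S : Graph γ δ)
  (h : ZMod 3 → S.vertexSet) (f : TutteRotorVertex ⊕ γ → A)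

theorem sum_zmod_three (a : ZMod 3 → A) (i : ZMod 3) : ∑ j, a j = a i + a (i + 1) + a (i + 2) := by
  rw [← Equiv.sum_comp (Equiv.addLeft i)]
  change ∑ j : Fin 3, _ = _
  rw [Fin.sum_univ_three]
  congr 2
  exact congrArg a (add_zero i)

theorem zmod_three_two_ne : (2 : ZMod 3) ≠ 0 ∧ (2 : ZMod 3) ≠ 1 := by
  decide

theorem zmod_three_add (i : ZMod 3) : i + 1 + 1 = i + 2 ∧ i + 2 + 1 = i ∧ i + 1 + 2 = i ∧
    i + 2 + 2 = i + 1 := by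
  revert i
  decide

theorem laplacian_tutteVariation_terminal (i : ZMod 3) :
    (tutteVariation S h).laplacian f (.inl (terminal i)) =
      4 • f (.inl (terminal i)) - f (.inl (mid i)) - f (.inl (mid (i + 2))) - f (.inl (.inner i))
        - f (.inr (h i)) := by
  classical
  rw [tutteVariation, Graph.laplacian_joinByEdges_inl, Graph.laplacian_ofSimpleGraph, sum_eq]
  simp only [sum_zmod_three _ i]
  simp [tutteRotor, Link, zmod_three_add, zmod_three_two_ne]
  module

theorem laplacian_tutteVariation_mid (i : ZMod 3) :
    (tutteVariation S h).laplacian f (.inl (mid i)) =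
      3 • f (.inl (mid i)) - f (.inl (terminal i)) - f (.inl (terminal (i + 1)))
        - f (.inl (.inner i)) := by
  classical
  rw [tutteVariation, Graph.laplacian_joinByEdges_inl, Graph.laplacian_ofSimpleGraph, sum_eq]
  simp only [sum_zmod_three _ i]
  simp [tutteRotor, Link, zmod_three_two_ne]
  module

theorem laplacian_tutteVariation_inner (i : ZMod 3) :
    (tutteVariation S h).laplacian f (.inl (.inner i)) =
      3 • f (.inl (.inner i)) - f (.inl (terminal i)) - f (.inl (mid i)) - f (.inl center) := by
  classical
  rw [tutteVariation, Graph.laplacian_joinByEdges_inl, Graph.laplacian_ofSimpleGraph, sum_eq]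
  simp only [sum_zmod_three _ i]
  simp [tutteRotor, Link, zmod_three_two_ne]
  module

theorem laplacian_tutteVariation_center :
    (tutteVariation S h).laplacian f (.inl center) =
      3 • f (.inl center) - ∑ i, f (.inl (.inner i)) := by
  classical
  rw [tutteVariation, Graph.laplacian_joinByEdges_inl, Graph.laplacian_ofSimpleGraph, sum_eq]
  simp only [sum_zmod_three _ 0]
  simp [tutteRotor, Link]
  module

theorem laplacian_tutteVariation_inr [DecidableEq γ] (k : γ) :
    (tutteVariation S h).laplacian f (.inr k) = S.laplacian (f ∘ .inr) k +
      ∑ i, if (h i : γ) = k then f (.inr k) - f (.inl (terminal i)) else 0 := by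
  rw [tutteVariation, Graph.laplacian_joinByEdges_inr]

/-- A function on the vertices of the supergraph is harmonic if it satisfies the equations at the
vertices of the rotor and at those of the back-graph. -/
theorem laplacian_tutteVariation_eq_zero_iff [DecidableEq γ] :
    (∀ v, (tutteVariation S h).laplacian f v = 0) ↔
      (∀ i, f (.inl (.inner i)) = 3 • f (.inl (mid i)) - f (.inl (terminal i))
        - f (.inl (terminal (i + 1)))) ∧
      (∀ i, f (.inl center) = 3 • f (.inl (.inner i)) - f (.inl (terminal i))
        - f (.inl (mid i))) ∧
      (∀ i, f (.inr (h i)) = 4 • f (.inl (terminal i)) - f (.inl (mid i))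
        - f (.inl (mid (i + 2))) - f (.inl (.inner i))) ∧
      3 • f (.inl center) = ∑ i, f (.inl (.inner i)) ∧
      ∀ k, S.laplacian (f ∘ .inr) k +
        ∑ i, (if (h i : γ) = k then f (.inr k) - f (.inl (terminal i)) else 0) = 0 := by
  constructor
  · intro H
    refine ⟨fun i => ?_, fun i => ?_, fun i => ?_, ?_, fun k => ?_⟩
    · exact (sub_eq_zero.1 ((laplacian_tutteVariation_mid S h f i).symm.trans (H _))).symm
    · exact (sub_eq_zero.1 ((laplacian_tutteVariation_inner S h f i).symm.trans (H _))).symm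
    · exact (sub_eq_zero.1 ((laplacian_tutteVariation_terminal S h f i).symm.trans (H _))).symm
    · exact sub_eq_zero.1 ((laplacian_tutteVariation_center S h f).symm.trans (H _))
    · exact (laplacian_tutteVariation_inr S h f k).symm.trans (H _)
  · rintro ⟨hu, ho, hs, hc, hk⟩ ((i | i | i | _) | k)
    · rw [laplacian_tutteVariation_terminal, hs, sub_self]
    · rw [laplacian_tutteVariation_mid, hu, sub_self]
    · rw [laplacian_tutteVariation_inner, ← ho, sub_self]
    · rw [laplacian_tutteVariation_center, hc, sub_self]
    · rw [laplacian_tutteVariation_inr, hk]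

end RotorLaplacian

/-! ### The integral substitute for reflecting the rotor -/

section RotorReflection

variable {γ δ A B : Type*} [AddCommGroup A] [AddCommGroup B]

/-- A substitute for the reflection `i ↦ r - i` of the rotor. It reflects the values of `f` at the
terminals, and it turns functions that are harmonic at the other vertices of the rotor into such
functions, reflecting the values of the Laplacian at the terminals. -/
def reflectRotor (r : ZMod 3) (f : TutteRotorVertex ⊕ γ → A) : TutteRotorVertex ⊕ γ → A
  | .inl (.terminal i) => f (.inl (terminal (r - i)))
  | .inl (.mid i) => f (.inl (mid (r - i + 1)))
      + 4 • (f (.inl (mid (r - i + 2))) - f (.inl (mid (r - i))))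
      + f (.inl (terminal (r - i))) + f (.inl (terminal (r - i + 1)))
      - 2 • f (.inl (terminal (r - i + 2)))
  -- For harmonic `f` this is forced by the previous branch, through the equation at `mid i`.
  | .inl (.inner i) => f (.inl (.inner (r - i + 1)))
      + 4 • (f (.inl (.inner (r - i + 2))) - f (.inl (.inner (r - i))))
      + 2 • (f (.inl (terminal (r - i))) - f (.inl (terminal (r - i + 2))))
  | .inl .center => f (.inl center)
  | .inr k => f (.inr k)

/-- The coefficients are integers, so the construction is natural in `A`. -/
theorem map_reflectRotor (φ : A →+ B) (r : ZMod 3) (f : TutteRotorVertex ⊕ γ → A)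
    (v : TutteRotorVertex ⊕ γ) : φ (reflectRotor r f v) = reflectRotor r (φ ∘ f) v := by
  rcases v with (i | i | i | _) | k <;> simp [reflectRotor]

theorem sub_add_zmod_three (r i : ZMod 3) : r - (i + 1) = r - i + 2 ∧ r - (i + 2) = r - i + 1 ∧
    r - (r - i + 1) = i + 2 ∧ r - (r - i + 2) = i + 1 := by
  revert r i
  decide

variable [Finite γ] {S : Graph γ δ} {h h' : ZMod 3 → S.vertexSet} {r : ZMod 3}
  {f : TutteRotorVertex ⊕ γ → A}

theorem laplacian_reflectRotor (hh : ∀ i, h' (r - i) = h i)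
    (hf : ∀ v, (tutteVariation S h').laplacian f v = 0) (v : TutteRotorVertex ⊕ γ) :
    (tutteVariation S h).laplacian (reflectRotor r f) v = 0 := by
  classical
  rw [laplacian_tutteVariation_eq_zero_iff] at hf
  obtain ⟨hu, ho, hs, hc, hk⟩ := hf
  revert v
  rw [laplacian_tutteVariation_eq_zero_iff]
  refine ⟨fun i => ?_, fun i => ?_, fun i => ?_, ?_, fun k => ?_⟩
  · have hua := hu (r - i)
    have hub := hu (r - i + 1)
    have huc := hu (r - i + 2)
    simp only [zmod_three_add] at hua hub huc
    simp only [reflectRotor, sub_add_zmod_three, hua, hub, huc]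
    module
  · have hoa := ho (r - i)
    have hob := ho (r - i + 1)
    have hoc := ho (r - i + 2)
    simp only [reflectRotor]
    linear_combination (norm := module) hob + (4 : ℤ) • hoc - (4 : ℤ) • hoa
  · have hoa := ho (r - i)
    have hoc := ho (r - i + 2)
    have hua := hu (r - i)
    have hub := hu (r - i + 1)
    have huc := hu (r - i + 2)
    have hsa := hs (r - i)
    rw [hh] at hsa
    simp only [zmod_three_add] at hua hub huc
    simp only [reflectRotor, sub_add_zmod_three, zmod_three_add]
    linear_combination (norm := module) hsa + hub + hua - (2 : ℤ) • huc
      + (2 : ℤ) • hoa - (2 : ℤ) • hoc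
  -- The correction terms at the inner vertices are differences of cyclic shifts, so they cancel in
  -- the sum.
  · rw [sum_zmod_three _ r] at hc
    rw [sum_zmod_three _ 0]
    simp only [reflectRotor, sub_add_zmod_three, zmod_three_add, sub_zero]
    rw [hc]
    module
  -- Values on `S` are unchanged; the sum over attachments is reindexed by `i ↦ r - i`.
  · refine Eq.trans (congrArg _ ?_) (hk k)
    conv_rhs => rw [← Equiv.sum_comp (Equiv.subLeft r)]
    simp only [Equiv.subLeft_apply, hh]
    rfl

theorem reflectRotor_reflectRotor (hf : ∀ v, (tutteVariation S h).laplacian f v = 0) :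
    reflectRotor r (reflectRotor r f) = f := by
  classical
  have hrf := laplacian_reflectRotor (h := h) (r := r) (h' := fun i => h (r - i)) (by simp)
    (laplacian_reflectRotor (h' := h) (r := r) (fun i => rfl) hf)
  rw [laplacian_tutteVariation_eq_zero_iff] at hf hrf
  obtain ⟨hu, ho, -⟩ := hf
  have ht (i : ZMod 3) : reflectRotor r (reflectRotor r f) (.inl (terminal i)) =
      f (.inl (terminal i)) := by
    simp [reflectRotor]
  have hm (i : ZMod 3) : reflectRotor r (reflectRotor r f) (.inl (mid i)) = f (.inl (mid i)) := by
    have hoa := ho i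
    have hob := ho (i + 1)
    have hoc := ho (i + 2)
    have hua := hu i
    have hub := hu (i + 1)
    have huc := hu (i + 2)
    simp only [zmod_three_add] at hua hub huc
    simp only [reflectRotor, sub_add_zmod_three, zmod_three_add, sub_sub_cancel]
    -- The weights 2, 2, -4 eliminate the center; tripled, they let the equations at the mids
    -- eliminate the inner values.
    linear_combination (norm := module) (2 : ℤ) • hob + (6 : ℤ) • hub + (2 : ℤ) • hoc
      + (6 : ℤ) • huc - (4 : ℤ) • hoa - (12 : ℤ) • hua
  ext v
  rcases v with (i | i | i | _) | k
  · exact ht i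
  · exact hm i
  -- Both functions satisfy the equations at the mids, which determine the inner values.
  · rw [hrf.1, hm, ht, ht, hu]
  · rfl
  · rfl

end RotorReflection

/-! ### Isomorphisms of Jacobians -/

section

variable {γ δ : Type*} {S : Graph γ δ} {h h' : ZMod 3 → S.vertexSet} {r : ZMod 3}

theorem inl_mem_vertexSet_tutteVariation (x : TutteRotorVertex) :
    .inl x ∈ (tutteVariation S h).vertexSet :=
  .inl ⟨x, Set.mem_univ _, rfl⟩

theorem inr_mem_vertexSet_tutteVariation {k : γ} :
    .inr k ∈ (tutteVariation S h).vertexSet ↔ k ∈ S.vertexSet := by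
  simp [tutteVariation, Graph.joinByEdges]

/-- The coefficients in each branch of `reflectRotor` sum to 1. -/
theorem picDegree_reflectRotor {v : TutteRotorVertex ⊕ γ}
    (hv : v ∈ (tutteVariation S h).vertexSet) :
    (tutteVariation S h').picDegree (reflectRotor r (tutteVariation S h').vertexClass v) = 1 := by
  have hd (x : TutteRotorVertex) : (tutteVariation S h').picDegree
      ((tutteVariation S h').vertexClass (.inl x)) = 1 :=
    Graph.picDegree_vertexClass _ (inl_mem_vertexSet_tutteVariation x)
  rw [map_reflectRotor]
  rcases v with (i | i | i | _) | k
  · exact hd _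
  · simp [reflectRotor, hd]
  · simp [reflectRotor, hd]
  · exact hd _
  · exact Graph.picDegree_vertexClass _
      (inr_mem_vertexSet_tutteVariation.2 (inr_mem_vertexSet_tutteVariation.1 hv))

variable [Finite γ]

/-- By naturality `φ` passes inside `reflectRotor`, which is then applied twice to a harmonic
function. -/
theorem eq_vertexClass_of_eq_reflectRotor
    (φ : (tutteVariation S h').Pic →+ (tutteVariation S h).Pic)
    (hφ : ∀ w ∈ (tutteVariation S h').vertexSet, φ ((tutteVariation S h').vertexClass w) =
      reflectRotor r (tutteVariation S h).vertexClass w) (v : TutteRotorVertex ⊕ γ) :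
    φ (reflectRotor r (tutteVariation S h').vertexClass v) =
      (tutteVariation S h).vertexClass v := by
  have : φ ∘ (tutteVariation S h').vertexClass =
      reflectRotor r (tutteVariation S h).vertexClass := by
    ext w
    by_cases hw : w ∈ (tutteVariation S h').vertexSet
    · exact hφ w hw
    · rcases w with x | k
      · exact absurd (inl_mem_vertexSet_tutteVariation x) hw
      -- Such a `k` is a vertex of neither supergraph, so both sides take the default value 0.
      · rw [Function.comp_apply, Graph.vertexClass_of_notMem _ hw, map_zero]
        rw [inr_mem_vertexSet_tutteVariation] at hw
        exact (Graph.vertexClass_of_notMem _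
          fun hk => hw (inr_mem_vertexSet_tutteVariation.1 hk)).symm
  rw [map_reflectRotor, this, reflectRotor_reflectRotor (Graph.laplacian_vertexClass _)]

/-- Reflecting Tutte's rotor does not change the Jacobian, for any back-graph. -/
theorem nonempty_jacobian_addEquiv_of_reflection (hh : ∀ i, h' (r - i) = h i) :
    Nonempty ((tutteVariation S h).jacobian ≃+ (tutteVariation S h').jacobian) := by
  have hh' (i : ZMod 3) : h (r - i) = h' i := by rw [← hh, sub_sub_cancel]
  exact Graph.nonempty_jacobian_addEquiv_of_harmonic
    (reflectRotor r (tutteVariation S h').vertexClass)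
    (reflectRotor r (tutteVariation S h).vertexClass)
    (laplacian_reflectRotor hh (Graph.laplacian_vertexClass _))
    (laplacian_reflectRotor hh' (Graph.laplacian_vertexClass _))
    (fun _ hv => picDegree_reflectRotor hv)
    (fun φ hφ v _ => eq_vertexClass_of_eq_reflectRotor φ hφ v)
    (fun φ hφ v _ => eq_vertexClass_of_eq_reflectRotor φ hφ v)

theorem perm_zmod_three_eq_reflection (σ : Equiv.Perm (ZMod 3)) :
    (∃ r, ∀ i, σ i = r - i) ∨ ∃ r s, ∀ i, σ i = r - (s - i) := by
  revert σ
  decide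

/-- Permuting the attachments of Tutte's rotor does not change the Jacobian, for any back-graph. -/
theorem nonempty_jacobian_addEquiv_of_perm (h : ZMod 3 → S.vertexSet) (σ : Equiv.Perm (ZMod 3)) :
    Nonempty ((tutteVariation S h).jacobian ≃+
      (tutteVariation S fun i => h (σ i)).jacobian) := by
  obtain ⟨r, hr⟩ | ⟨r, s, hrs⟩ := perm_zmod_three_eq_reflection σ
  · exact nonempty_jacobian_addEquiv_of_reflection (r := r) fun i => by rw [hr, sub_sub_cancel]
  · obtain ⟨e⟩ := nonempty_jacobian_addEquiv_of_reflection (S := S) (h := h)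
      (h' := fun i => h (r - i)) (r := r) fun i => by rw [sub_sub_cancel]
    obtain ⟨e'⟩ := nonempty_jacobian_addEquiv_of_reflection (S := S) (h := fun i => h (r - i))
      (h' := fun i => h (σ i)) (r := s) fun i => by rw [hrs, sub_sub_cancel]
    exact ⟨e.trans e'⟩

end

/-- Here `g i` is the image in the cycle `S = C_n` of the terminal `f^i(v)` of Tutte's rotor. The
first supergraph joins each terminal to its image. The second one joins `f^i(v)` to the image of
the terminal `σ (f^i(v))`: a transposition `σ` reflects the rotor before it is attached, and
`σ i = i + 1` gives the rule that joins `f^i(v)` to `g (f^(i+1)(v))`. -/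
theorem mainTheorem5 (n : ℕ) (hn : 2 ≤ n) (g : ZMod 3 → (Graph.cycleMultigraph n).vertexSet)
    (σ : Equiv.Perm (ZMod 3)) :
    Nonempty ((tutteVariation (Graph.cycleMultigraph n) g).jacobian ≃+
      (tutteVariation (Graph.cycleMultigraph n) (fun i => g (σ i))).jacobian) := by
  -- Gives finiteness of `ZMod n`, since `ZMod 0` is infinite.
  have : NeZero n := ⟨by omega⟩
  exact nonempty_jacobian_addEquiv_of_perm g σ
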